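/- **Setting.** Let $d\ge 0$, $K\ge 1$ and $T\ge 2$ be integers, and let $P$ be the law of a pair $(\mathbf Z,\mathbf y)$ with $\mathbf Z\in[0,1]^d$ (a flattened prompt) and $\mathbf y\in\{0,1\}^K$ a one-hot label vector. Let $\mathcal S^K$ be the probability simplex in $\mathbb R^K$, and let $\mathbf p_0:[0,1]^d\to\mathcal S^K$ be a measurable version of the true conditional class probabilities, $p^0_k(\mathbf Z)=\mathbb P(y_k=1\mid \mathbf Z)$. Let $\mathcal D_T=\{(\mathbf Z^{(t)},\mathbf y^{(t)})\}_{t=1}^T$ be i.i.d. with law $P$, and let $(\mathbf Z,\mathbf y)\sim P$ be independent of $\mathcal D_T$. Let $\mathcal F$ be any class of measurable functions $\mathbf p=(p_1,\dots,p_K)^\top:\mathbb R^d\to\mathbb R^K$ whose values on $[0,1]^d$ lie in $\mathcal S^K$, such that for every $\mathbf p\in\mathcal F$ there are constants $C_1>0$ and $0<C_2<1$ with $p_k(\mathbf z)\ge C_1/T^{C_2}$ for all $k$ and all $\mathbf z\in[0,1]^d$ (for instance, constants common to all of $\mathcal F$). Let $\widehat{\mathbf p}$ be an estimator with values in $\mathcal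 F$, i.e. a function of $\mathcal D_T$ such that $\widehat{\mathbf p}(\mathbf z)$ is jointly measurable in $(\mathcal D_T,\mathbf z)$. For $B\geq 2$ define, with logarithms taken coordinatewise, $$R_B(\mathbf p_0,\widehat{\mathbf p})=\mathbb E_{\mathcal D_T,\mathbf Z}\Big[\sum_{k=1}^K p_k^0(\mathbf Z)\min\Big\{B,\log\frac{p_k^0(\mathbf Z)}{\widehat p_k(\mathbf Z)}\Big\}\Big],\qquad R(\mathbf p_0,\mathbf p)=\mathbb E_{\mathbf Z}\Big[\sum_{k=1}^K p_k^0(\mathbf Z)\log\frac{p_k^0(\mathbf Z)}{p_k(\mathbf Z)}\Big],$$ $$\ell(\mathbf p,\mathcal D_T)=-\frac1T\sum_{t=1}^T \mathbf y^{(t)\top}\log\mathbf p(\mathbf Z^{(t)}),\qquad \Delta_T(\mathbf p_0,\widehat{\mathbf p})=\mathbb E_{\mathcal D_T}\Big[\ell(\widehat{\mathbf p},\mathcal D_T)-\inf_{\mathbf p\in\mathcal F}\ell(\mathbf p,\mathcal D_T)\Big].$$ Let $\log(\mathcal F)=\{(\log p_1,\dots,\log p_K)^\top:\mathbf p\in\mathcal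 F\}$, and let $$\mathcal N_T=\sup_{\mathbf z^{(1)},\dots,\mathbf z^{(T)}\in\mathbb R^d}\mathcal N\big(1/T,\ \log(\mathcal F),\ \|\cdot\|_{\infty,\mathcal Z_T}\big)\in\{1,2,\dots\}\cup\{\infty\}$$ be the uniform empirical covering number, where $\mathcal N(\delta,\mathcal G,\|\cdot\|_{\infty,\mathcal Z_T})$ is the smallest cardinality of a finite set $\mathcal G(\delta)$ of functions $\mathbb R^d\to\mathbb R^K$ such that every $\mathbf f\in\mathcal G$ has a $\mathbf g\in\mathcal G(\delta)$ with $\max_{t\le T}\max_{k\le K}|f_k(\mathbf z^{(t)})-g_k(\mathbf z^{(t)})|\le\delta$ (and $\infty$ if there is none). (Where a $p_k$ is not positive, which is possible only outside $[0,1]^d$, $\log p_k$ is read as $\log|p_k|$, and $\log 0$ as $0$.) **Theorem (Oracle inequality).** There is a universal constant $C>0$ such that in every such setting, for every truncation level $B\ge 2$ and every task number $T\geq 2$, $$R_B(\mathbf p_0,\widehat{\mathbf p})\le C\left(\inf_{\mathbf p\in\mathcal F}R(\mathbf p_0,\mathbf p)+\Delta_T(\mathbf p_0,\widehat{\mathbf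 p})+\frac{B^2\,\log(\max\{\mathcal N_T,2\})\,\log^2T}{T}\right).$$ -/

import Mathlib

open scoped NNReal ENNReal
open MeasureTheory

namespace ICL

/-- (Flattened) prompts, vectors of `ℝ^d`. -/
abbrev Prompt (d : ℕ) : Type := Fin d → ℝ

/-- The cube `[0,1]^d`. -/
def cube (d : ℕ) : Set (Prompt d) := Set.Icc 0 1

/-- Functions `ℝ^d → ℝ^K`. -/
abbrev VecFun (d K : ℕ) : Type := Prompt d → Fin K → ℝ

/-- A prompt together with the class of its query. -/
abbrev Obs (d K : ℕ) : Type := Prompt d × Fin K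

/-- A data set of `T` tasks. -/
abbrev Data (d K T : ℕ) : Type := Fin T → Obs d K

/-- The one-hot label vector of the class `c`. -/
def oneHot {K : ℕ} (c : Fin K) : Fin K → ℝ := Pi.single c 1

/-- `p` is a conditional class probability function: on the cube its values lie in the simplex. -/
def IsClassProb {d K : ℕ} (p : VecFun d K) : Prop :=
  ∀ z ∈ cube d, p z ∈ stdSimplex ℝ (Fin K)

/-- `p₀` is (a version of) the true conditional class probability function of the law `P` of
`(Z, y)`: `p₀ k (Z) = ℙ (y_k = 1 | Z)`. -/
structure IsTrueClassProb {d K : ℕ} (P : Measure (Obs d K)) (p₀ : VecFun d K) : Prop where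
  measurable : Measurable p₀
  classProb : IsClassProb p₀
  cond : ∀ (k : Fin K) (A : Set (Prompt d)), MeasurableSet A →
    P (A ×ˢ {k}) = ∫⁻ z in A, ENNReal.ofReal (p₀ z k) ∂P.fst

/-- The law of a data set of `T` independent observations with law `P`. -/
noncomputable def dataLaw {d K : ℕ} (P : Measure (Obs d K)) (T : ℕ) : Measure (Data d K T) :=
  Measure.pi fun _ => P

/-- `KL (q ‖ r) = ∑ k, q k * log (q k / r k)` for probability vectors, `r` with positive entries. -/
noncomputable def kl {K : ℕ} (q r : Fin K → ℝ) : ℝ :=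
  ∑ k, q k * Real.log (q k / r k)

/-- The Kullback–Leibler divergence truncated at level `B`. -/
noncomputable def truncKL {K : ℕ} (B : ℝ) (q r : Fin K → ℝ) : ℝ :=
  ∑ k, q k * min B (Real.log (q k / r k))

/-- The risk `R (p₀, p) = 𝔼_Z [KL (p₀ (Z) ‖ p (Z))]` of a fixed function `p`. -/
noncomputable def risk {d K : ℕ} (P : Measure (Obs d K)) (p₀ p : VecFun d K) : ℝ≥0∞ :=
  ∫⁻ z, ENNReal.ofReal (kl (p₀ z) (p z)) ∂P.fst

/-- The expected excess risk `R_B (p₀, p̂) = 𝔼_{D, Z} [KL_B (p₀ (Z) ‖ p̂ (Z))]` of an estimator;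
the prompt `Z` is independent of the data set `D`. -/
noncomputable def truncRisk {d K T : ℕ} (P : Measure (Obs d K)) (B : ℝ) (p₀ : VecFun d K)
    (phat : Data d K T → VecFun d K) : ℝ :=
  ∫ x : Data d K T × Prompt d, truncKL B (p₀ x.2) (phat x.1 x.2) ∂((dataLaw P T).prod P.fst)

/-- The empirical negative log-likelihood `-(1/T) ∑ t, y⁽ᵗ⁾ᵀ log p (Z⁽ᵗ⁾)`. -/
noncomputable def empRisk {d K T : ℕ} (D : Data d K T) (p : VecFun d K) : ℝ :=
  -(1 / (T : ℝ)) * ∑ t, ∑ k, oneHot (D t).2 k * Real.log (p (D t).1 k)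

/-- The expected empirical risk gap of an estimator, relative to the class `F`. The integrand is
nonnegative when `phat D ∈ F` and the prompts lie in the cube, so the expectation is taken in
`[0, ∞]`; the minimum over `F` is read as an infimum, which is bounded below by `0`. -/
noncomputable def empGap {d K T : ℕ} (P : Measure (Obs d K)) (F : Set (VecFun d K))
    (phat : Data d K T → VecFun d K) : ℝ≥0∞ :=
  ∫⁻ D, ENNReal.ofReal (empRisk D (phat D) - ⨅ p : F, empRisk D p.1) ∂(dataLaw P T)

/-- The coordinatewise logarithm of a class of functions. -/
def logClass {d K : ℕ} (F : Set (VecFun d K)) : Set (VecFun d K) :=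
  (fun p z k => Real.log (p z k)) '' F

/-- The pseudometric `max_t max_k |f_k (Z⁽ᵗ⁾) - g_k (Z⁽ᵗ⁾)|` on functions, pulled back from the
sup metric along the evaluation at the points `Z⁽ᵗ⁾`. -/
noncomputable abbrev empMetric {d K T : ℕ} (Z : Fin T → Prompt d) :
    PseudoEMetricSpace (VecFun d K) :=
  PseudoEMetricSpace.induced (fun f t => f (Z t)) inferInstance

/-- The smallest cardinality of a `δ`-cover of `F` (by arbitrary functions) for the empirical
pseudometric at `Z⁽¹⁾, …, Z⁽ᵀ⁾`. -/
noncomputable def empCoveringNumber {d K T : ℕ} (δ : ℝ≥0) (F : Set (VecFun d K))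
    (Z : Fin T → Prompt d) : ℕ∞ :=
  @Metric.externalCoveringNumber (VecFun d K) (empMetric Z) δ F

/-- The uniform empirical covering number `𝒩_∞ (δ, F, T)`. -/
noncomputable def unifCoveringNumber {d K : ℕ} (δ : ℝ≥0) (F : Set (VecFun d K)) (T : ℕ) : ℕ∞ :=
  ⨆ Z : Fin T → Prompt d, empCoveringNumber δ F Z

/-- Covers for the empirical pseudometric, written out in coordinates. -/
theorem isCover_empMetric_iff {d K T : ℕ} (δ : ℝ≥0) (F G : Set (VecFun d K))
    (Z : Fin T → Prompt d) :
    @Metric.IsCover (VecFun d K) (empMetric Z) δ F G ↔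
      ∀ f ∈ F, ∃ g ∈ G, ∀ t k, |f (Z t) k - g (Z t) k| ≤ δ := by
  have h : ∀ f g : VecFun d K, (edist (fun t => f (Z t)) (fun t => g (Z t)) ≤ (δ : ℝ≥0∞)) ↔
      ∀ t k, |f (Z t) k - g (Z t) k| ≤ δ := by
    intro f g
    simp only [edist_pi_le_iff]
    refine forall_congr' fun t => forall_congr' fun k => ?_
    rw [edist_dist, ← ENNReal.ofReal_coe_nnreal, ENNReal.ofReal_le_ofReal_iff δ.coe_nonneg,
      Real.dist_eq]
  constructor
  · intro H f hf
    obtain ⟨g, hg, hfg⟩ := H hf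
    exact ⟨g, hg, (h f g).1 hfg⟩
  · intro H f hf
    obtain ⟨g, hg, hfg⟩ := H f hf
    exact ⟨g, hg, (h f g).2 hfg⟩

/-- The logarithm of a cardinality, with value `∞` at `∞`. -/
noncomputable def logCard : ℕ∞ → ℝ≥0∞
  | ⊤ => ⊤
  | (n : ℕ) => ENNReal.ofReal (Real.log n)

/-- Every member of `F` is bounded below on the cube by some `C₁ / T ^ C₂`, `C₁ > 0`,
`0 < C₂ < 1`. -/
def ProbLowerBound {d K : ℕ} (F : Set (VecFun d K)) (T : ℕ) : Prop :=
  ∀ p ∈ F, ∃ C₁ C₂ : ℝ, 0 < C₁ ∧ 0 < C₂ ∧ C₂ < 1 ∧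
    ∀ z ∈ cube d, ∀ k, C₁ / (T : ℝ) ^ C₂ ≤ p z k

end ICL

/-! Let `A` be the expected sum of the divergences `truncKL` of the estimator at the `T` sample
prompts, and `S` the expected sum of its truncated log-likelihood ratios. Three estimates are
chained. (1) For fixed `p`, `exp_neg_min_le` averaged over the labels gives `truncKL / (4B) -
truncLogRatio / (2B)` a conditional exponential moment of at most one, with no separate variance
bound. Given the prompts, labels are independent, so this tensorizes; a maximal inequality over a
finite net at the prompts makes it uniform over `F`, and `A / 2 - S ≤ 3 + 2B log M`
(`integral_sum_truncKL_le`). (2) A ghost sample and random swaps compare the risk at a fresh prompt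
with `A`: divergences lie in `[0, B]`, so `exp_add_exp_le_two` bounds the exponential moment of each
swap, whence `T * R_B ≤ 3A + 8 + 4B log M` (`mul_truncRisk_le`). (3) Truncation only lowers the
log-ratio, so `S / T` is at most the risk of any comparator plus the empirical gap
(`ofReal_integral_truncLogRatio_le`). Together the remainder is of order `B log M / T`; the lower
bound on `F` enters only through positivity and integrability. -/

namespace ICL

/-! ### Scalar inequalities -/

/-- Expanding, the claim is `2(1 - e⁻ᵘ) ≤ u(1 + e⁻ᵘ)`, which is `2x / (x + 2) ≤ log (1 + x)` at `x =
eᵘ - 1`. -/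
theorem sq_le_two_add_mul_sub_one_add_exp_neg {u : ℝ} (hu : 0 ≤ u) :
    u ^ 2 ≤ (2 + u) * (u - 1 + Real.exp (-u)) := by
  have h1 : 1 ≤ Real.exp u := Real.one_le_exp hu
  have h2 := Real.le_log_one_add_of_nonneg (x := Real.exp u - 1) (by linarith)
  rw [add_sub_cancel, Real.log_exp, div_le_iff₀ (by linarith)] at h2
  have h3 : Real.exp u * Real.exp (-u) = 1 := by rw [← Real.exp_add]; simp
  have h4 : 0 < Real.exp (-u) := Real.exp_pos _
  have h5 := mul_le_mul_of_nonneg_right h2 h4.le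
  nlinarith

/-- In the power series this is `2ⁿ ≥ 4` for `n ≥ 2`. Here the same logarithm bound is used: with `s
= eʷ`, the difference times `s + 1` is at least `(s - 1)³`. -/
theorem four_mul_exp_sub_le {w : ℝ} (hw : 0 ≤ w) :
    4 * (Real.exp w - 1 - w) ≤ Real.exp (2 * w) - 1 - 2 * w := by
  have h1 : 1 ≤ Real.exp w := Real.one_le_exp hw
  have h2 := Real.le_log_one_add_of_nonneg (x := Real.exp w - 1) (by linarith)
  rw [add_sub_cancel, Real.log_exp, div_le_iff₀ (by linarith)] at h2
  have h3 : Real.exp (2 * w) = Real.exp w ^ 2 := by rw [← Real.exp_nat_mul]; norm_num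
  rw [h3]
  set s := Real.exp w
  have h4 : 0 ≤ (s - 1) ^ 3 := by have : 0 ≤ s - 1 := by linarith
                                  positivity
  have h5 : 0 ≤ (s + 1) * (s ^ 2 - 1 - 2 * w - 4 * (s - 1 - w)) := by nlinarith
  have := nonneg_of_mul_nonneg_right h5 (by linarith)
  linarith

theorem exp_mul_le_of_mem_Icc {a v : ℝ} (h0 : 0 ≤ a) (h1 : a ≤ 1) :
    Real.exp (a * v) ≤ 1 - a + a * Real.exp v := by
  have := convexOn_exp.2 (Set.mem_univ (0 : ℝ)) (Set.mem_univ v) (sub_nonneg.2 h1) h0 (by ring)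
  simpa [smul_eq_mul] using this

theorem exp_neg_le_quadratic {x : ℝ} (hx : 0 ≤ x) : Real.exp (-x) ≤ 1 - x + x ^ 2 / 2 := by
  have h := Real.quadratic_le_exp_of_nonneg hx
  have h3 : Real.exp x * Real.exp (-x) = 1 := by rw [← Real.exp_add]; simp
  have h4 : 0 < Real.exp (-x) := Real.exp_pos _
  have h5 : (1 + x + x ^ 2 / 2) * Real.exp (-x) ≤ 1 := by nlinarith
  have h6 : (1 + x + x ^ 2 / 2) * (1 - x + x ^ 2 / 2) = 1 + x ^ 4 / 4 := by ring
  have h7 : 0 < 1 + x + x ^ 2 / 2 := by positivity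
  have h8 : 0 ≤ x ^ 4 := by positivity
  nlinarith

/-- The remainder of `exp` at the truncated value `-(min B u) / (2 * B)` is dominated by the
linear scale. -/
theorem exp_neg_min_le {B u : ℝ} (hB : 2 ≤ B) :
    Real.exp (-(min B u / (2 * B))) - 1 + min B u / (2 * B) ≤
      1 / (4 * B) * (min B u + Real.exp (-u) - 1) := by
  have hB0 : 0 < B := by linarith
  rcases le_total u B with h | h
  · rw [min_eq_right h]
    rcases le_total u 0 with hu | hu
    · have h1 := four_mul_exp_sub_le (w := -u / 2) (by linarith)
      have h2 := exp_mul_le_of_mem_Icc (a := 1 / B) (v := -u / 2) (by positivity)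
        (by rw [div_le_one hB0]; linarith)
      rw [show 2 * (-u / 2) = -u by ring] at h1
      rw [show 1 / B * (-u / 2) = -(u / (2 * B)) by field_simp] at h2
      have h3 : Real.exp (-(u / (2 * B))) - 1 + u / (2 * B) ≤
          1 / B * (Real.exp (-u / 2) - 1 - -u / 2) := by
        have : u / (2 * B) = 1 / B * (u / 2) := by field_simp
        rw [this] at h2 ⊢
        linarith
      refine h3.trans ?_
      have h4 := mul_le_mul_of_nonneg_left h1 (show 0 ≤ 1 / (4 * B) by positivity)
      calc _ = 1 / (4 * B) * (4 * (Real.exp (-u / 2) - 1 - -u / 2)) := by field_simp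
        _ ≤ _ := by rw [show u + Real.exp (-u) - 1 = Real.exp (-u) - 1 - -u by ring]; exact h4
    · have h1 := exp_neg_le_quadratic (x := u / (2 * B)) (by positivity)
      have h2 := sq_le_two_add_mul_sub_one_add_exp_neg hu
      have h3 : 0 ≤ u - 1 + Real.exp (-u) := by linarith [Real.add_one_le_exp (-u)]
      -- `2 + u ≤ 2 + B ≤ 2B`, by `B ≥ 2`.
      have h4 : u ^ 2 ≤ 2 * B * (u - 1 + Real.exp (-u)) :=
        h2.trans (mul_le_mul_of_nonneg_right (by linarith) h3)
      have h5 := mul_le_mul_of_nonneg_left h4 (show 0 ≤ 1 / (8 * B ^ 2) by positivity)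
      have h6 : 1 / (8 * B ^ 2) * u ^ 2 = (u / (2 * B)) ^ 2 / 2 := by field_simp; ring
      have h7 : 1 / (8 * B ^ 2) * (2 * B * (u - 1 + Real.exp (-u))) =
          1 / (4 * B) * (u + Real.exp (-u) - 1) := by field_simp; ring
      rw [h6, h7] at h5
      linarith
  · rw [min_eq_left h]
    have h1 := exp_neg_le_quadratic (x := B / (2 * B)) (by positivity)
    have h2 : B / (2 * B) = 1 / 2 := by field_simp
    rw [h2] at h1 ⊢
    have h3 := Real.exp_pos (-u)
    -- Beyond the truncation the left side is at most `1/8`, and `(B - 1) / (4B) ≥ 1/8` exactly when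
    -- `B ≥ 2`.
    have h4 : (1 : ℝ) / 8 ≤ 1 / (4 * B) * (B + Real.exp (-u) - 1) := by
      rw [div_mul_eq_mul_div, div_le_div_iff₀ (by norm_num) (by positivity)]
      linarith
    linarith

/-- The coefficient 3 splits `y - 3x` into the drift `-(x + y)` and the symmetric part `2(y - x)`.
Then `cosh t ≤ exp (t² / 2)`, and `2(y - x)² ≤ x + y` on `[0, 1/2]`. -/
theorem exp_add_exp_le_two {x y : ℝ} (hx0 : 0 ≤ x) (hy0 : 0 ≤ y) (hx : x ≤ 1 / 2) (hy : y ≤ 1 / 2) :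
    Real.exp (y - 3 * x) + Real.exp (x - 3 * y) ≤ 2 := by
  have h1 : Real.exp (y - 3 * x) + Real.exp (x - 3 * y) =
      2 * (Real.exp (-(x + y)) * Real.cosh (2 * (y - x))) := by
    rw [Real.cosh_eq, show y - 3 * x = -(x + y) + 2 * (y - x) by ring,
      show x - 3 * y = -(x + y) + -(2 * (y - x)) by ring, Real.exp_add, Real.exp_add]
    ring
  have h2 := Real.cosh_le_exp_half_sq (2 * (y - x))
  have h3 : Real.exp (-(x + y)) * Real.cosh (2 * (y - x)) ≤ 1 := by
    calc _ ≤ Real.exp (-(x + y)) * Real.exp ((2 * (y - x)) ^ 2 / 2) := by gcongr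
      _ = Real.exp (-(x + y) + (2 * (y - x)) ^ 2 / 2) := (Real.exp_add _ _).symm
      _ ≤ 1 := Real.exp_le_one_iff.2 (by nlinarith [mul_nonneg hx0 hy0])
  linarith

/-- A maximal inequality: variables with exponential moments at most one, indexed by at most `M`
indices, have an expected maximum of at most `log M`. -/
theorem sum_weight_mul_le_add_log {Ω ι : Type*} [Fintype Ω] [Fintype ι] (w : Ω → ℝ)
    (hw : ∀ ω, 0 ≤ w ω) (hw1 : ∑ ω, w ω = 1) (Y : ι → Ω → ℝ) (X : Ω → ℝ) (e M : ℝ) (hM : 0 < M)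
    (hcard : (Fintype.card ι : ℝ) ≤ M) (hY : ∀ i, ∑ ω, w ω * Real.exp (Y i ω) ≤ 1)
    (hX : ∀ ω, ∃ i, X ω ≤ Y i ω + e) : ∑ ω, w ω * X ω ≤ e + Real.log M := by
  have h1 : ∀ ω, X ω ≤ e + Real.log M - 1 + (∑ i, Real.exp (Y i ω)) / M := by
    intro ω
    obtain ⟨i, hi⟩ := hX ω
    -- The tangent of `exp` at `log M` replaces Jensen's inequality, and the maximum over indices is
    -- bounded by the sum.
    have h2 := Real.add_one_le_exp (Y i ω - Real.log M)
    rw [Real.exp_sub, Real.exp_log hM] at h2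
    have h3 : Real.exp (Y i ω) / M ≤ (∑ i, Real.exp (Y i ω)) / M :=
      div_le_div_of_nonneg_right (Finset.single_le_sum (f := fun i => Real.exp (Y i ω))
        (fun _ _ => (Real.exp_pos _).le) (Finset.mem_univ i)) hM.le
    linarith
  calc ∑ ω, w ω * X ω
      ≤ ∑ ω, w ω * (e + Real.log M - 1 + (∑ i, Real.exp (Y i ω)) / M) :=
        Finset.sum_le_sum fun ω _ => mul_le_mul_of_nonneg_left (h1 ω) (hw ω)
    _ = e + Real.log M - 1 + (∑ i, ∑ ω, w ω * Real.exp (Y i ω)) / M := by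
        rw [Finset.sum_comm, Finset.sum_div]
        simp_rw [mul_add, Finset.sum_add_distrib, ← Finset.sum_mul, hw1, one_mul, ← Finset.mul_sum,
          mul_div_assoc]
    _ ≤ e + Real.log M - 1 + 1 := by
        gcongr
        rw [div_le_one hM]
        refine le_trans (Finset.sum_le_sum fun i _ => hY i) ?_
        simpa using hcard
    _ = _ := by ring

/-! ### Truncated divergences of probability vectors -/

section TruncKL

variable {K : ℕ} {B : ℝ} {q r s : Fin K → ℝ}

theorem truncKL_le (hq : q ∈ stdSimplex ℝ (Fin K)) : truncKL B q r ≤ B := by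
  calc truncKL B q r ≤ ∑ k, q k * B :=
        Finset.sum_le_sum fun k _ => mul_le_mul_of_nonneg_left (min_le_left _ _) (hq.1 k)
    _ = B := by rw [← Finset.sum_mul, hq.2, one_mul]

/-- Where `q k > 0` the summand is `r k`; where `q k = 0` it vanishes, so mass of `r` may be lost.
-/
theorem sum_mul_exp_neg_log_div_le (hq : q ∈ stdSimplex ℝ (Fin K))
    (hr : r ∈ stdSimplex ℝ (Fin K)) (hpos : ∀ k, 0 < r k) :
    ∑ k, q k * Real.exp (-Real.log (q k / r k)) ≤ 1 := by
  rw [← hr.2]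
  refine Finset.sum_le_sum fun k _ => ?_
  rcases (hq.1 k).eq_or_lt with h | h
  · rw [← h, zero_mul]; exact (hpos k).le
  · rw [← Real.log_inv, Real.exp_log (by have := hpos k; positivity)]
    have := hpos k
    apply le_of_eq
    field_simp

/-- Average `exp_neg_min_le` over `q`: the linear term is `truncKL / (2B)`, half of which absorbs
the remainder, since `∑ q e⁻ᵘ - 1 ≤ 0`. -/
theorem sum_mul_exp_neg_min_log_le (hB : 2 ≤ B) (hq : q ∈ stdSimplex ℝ (Fin K))
    (hr : r ∈ stdSimplex ℝ (Fin K)) (hpos : ∀ k, 0 < r k) :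
    ∑ k, q k * Real.exp (-(min B (Real.log (q k / r k)) / (2 * B))) ≤
      1 - truncKL B q r / (4 * B) := by
  have hB0 : 0 < B := by linarith
  have h1 : ∑ k, q k * (Real.exp (-(min B (Real.log (q k / r k)) / (2 * B))) - 1 +
      min B (Real.log (q k / r k)) / (2 * B)) ≤
      ∑ k, q k * (1 / (4 * B) * (min B (Real.log (q k / r k)) +
        Real.exp (-Real.log (q k / r k)) - 1)) :=
    Finset.sum_le_sum fun k _ => mul_le_mul_of_nonneg_left (exp_neg_min_le hB) (hq.1 k)
  have h2 : ∑ k, q k * (Real.exp (-(min B (Real.log (q k / r k)) / (2 * B))) - 1 +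
      min B (Real.log (q k / r k)) / (2 * B)) =
      ∑ k, q k * Real.exp (-(min B (Real.log (q k / r k)) / (2 * B))) - 1 +
        truncKL B q r / (2 * B) := by
    simp_rw [mul_add, mul_sub, Finset.sum_add_distrib, Finset.sum_sub_distrib, mul_one, hq.2,
      truncKL, Finset.sum_div, mul_div_assoc]
  have h3 : ∑ k, q k * (1 / (4 * B) * (min B (Real.log (q k / r k)) +
        Real.exp (-Real.log (q k / r k)) - 1)) =
      1 / (4 * B) * (truncKL B q r + ∑ k, q k * Real.exp (-Real.log (q k / r k)) - 1) := by
    simp_rw [mul_left_comm (q _), ← Finset.mul_sum, mul_sub, mul_add, Finset.sum_sub_distrib,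
      Finset.sum_add_distrib, mul_one, hq.2, truncKL]
    ring
  rw [h2, h3] at h1
  have h4 := mul_le_mul_of_nonneg_left (sum_mul_exp_neg_log_div_le hq hr hpos)
    (show 0 ≤ 1 / (4 * B) by positivity)
  have h5 : truncKL B q r / (2 * B) = 2 * (truncKL B q r / (4 * B)) := by field_simp; norm_num
  have h6 : 1 / (4 * B) * truncKL B q r = truncKL B q r / (4 * B) := by field_simp
  rw [mul_sub, mul_add, h6] at h1
  linarith

/-- Truncation lowers the divergence, so Gibbs' inequality does not suffice. Comparing `1 - v ≤ e⁻ᵛ`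
with the previous bound gives `κ / (4B) ≤ κ / (2B)` for `κ = truncKL B q r`. -/
theorem truncKL_nonneg (hB : 2 ≤ B) (hq : q ∈ stdSimplex ℝ (Fin K))
    (hr : r ∈ stdSimplex ℝ (Fin K)) (hpos : ∀ k, 0 < r k) : 0 ≤ truncKL B q r := by
  have hB0 : 0 < B := by linarith
  have h1 := sum_mul_exp_neg_min_log_le hB hq hr hpos
  have h2 : ∑ k, q k * (1 - min B (Real.log (q k / r k)) / (2 * B)) ≤
      ∑ k, q k * Real.exp (-(min B (Real.log (q k / r k)) / (2 * B))) :=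
    Finset.sum_le_sum fun k _ => mul_le_mul_of_nonneg_left
      (by linarith [Real.add_one_le_exp (-(min B (Real.log (q k / r k)) / (2 * B)))]) (hq.1 k)
  have h3 : ∑ k, q k * (1 - min B (Real.log (q k / r k)) / (2 * B)) =
      1 - truncKL B q r / (2 * B) := by
    simp_rw [mul_sub, Finset.sum_sub_distrib, mul_one, hq.2, truncKL, Finset.sum_div,
      mul_div_assoc]
  have h5 : truncKL B q r / (2 * B) = 2 * (truncKL B q r / (4 * B)) := by field_simp; norm_num
  have h6 : 0 ≤ truncKL B q r / (4 * B) := by linarith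
  by_contra! h
  exact absurd (div_neg_of_neg_of_pos h (show 0 < 4 * B by positivity)) (by linarith)

theorem min_log_div_le_add {a x y e : ℝ} (ha : 0 ≤ a) (hx : 0 < x) (hy : 0 < y)
    (h : |Real.log x - Real.log y| ≤ e) :
    min B (Real.log (a / x)) ≤ min B (Real.log (a / y)) + e := by
  rcases ha.eq_or_lt with rfl | ha
  -- With `a = 0` both logarithms are `log 0 = 0`, so the two minima coincide.
  · simpa using (abs_nonneg _).trans h
  rw [Real.log_div ha.ne' hx.ne', Real.log_div ha.ne' hy.ne', ← min_add_add_right]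
  have := abs_le.1 h
  exact min_le_min (by linarith [abs_nonneg (Real.log x - Real.log y)]) (by linarith)

theorem truncKL_le_add {e : ℝ} (hq : q ∈ stdSimplex ℝ (Fin K)) (hr : ∀ k, 0 < r k)
    (hs : ∀ k, 0 < s k) (h : ∀ k, |Real.log (r k) - Real.log (s k)| ≤ e) :
    truncKL B q r ≤ truncKL B q s + e := by
  calc truncKL B q r ≤ ∑ k, q k * (min B (Real.log (q k / s k)) + e) := by
        refine Finset.sum_le_sum fun k _ => ?_
        exact mul_le_mul_of_nonneg_left (min_log_div_le_add (hq.1 k) (hr k) (hs k) (h k)) (hq.1 k)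
    _ = _ := by simp_rw [mul_add, Finset.sum_add_distrib, ← Finset.sum_mul, hq.2, one_mul, truncKL]

end TruncKL

/-! ### Densities and the law of a data set -/

theorem lintegral_pi_prod_eq_prod {n : ℕ} {E : Type*} [MeasurableSpace E] (μ : Measure E)
    [SigmaFinite μ] (f : Fin n → E → ℝ≥0∞) (hf : ∀ i, Measurable (f i)) :
    ∫⁻ x, ∏ i, f i (x i) ∂(Measure.pi fun _ => μ) = ∏ i, ∫⁻ x, f i x ∂μ := by
  induction n with
  | zero => simp
  | succ n ih =>
    calc
      _ = ∫⁻ x : E × (Fin n → E), f 0 x.1 * ∏ i : Fin n, f i.succ (x.2 i)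
          ∂(μ.prod (Measure.pi fun _ => μ)) := by
        have hm : Measurable fun x : Fin (n + 1) → E => ∏ i, f i (x i) :=
          Finset.measurable_prod _ fun i _ => (hf i).comp (measurable_pi_apply i)
        rw [← ((measurePreserving_piFinSuccAbove (fun _ : Fin (n + 1) => μ) 0).symm).lintegral_comp
          hm]
        simp [Fin.prod_univ_succ, MeasurableEquiv.piFinSuccAbove, Fin.insertNthEquiv]
      _ = _ := by
        rw [lintegral_prod_mul (hf 0).aemeasurable (g := fun y : Fin n → E => ∏ i, f i.succ (y i))
          (Finset.measurable_prod _ fun i _ =>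
            (hf i.succ).comp (measurable_pi_apply i)).aemeasurable, ih _ fun i => hf i.succ,
          Fin.prod_univ_succ]

theorem pi_withDensity {n : ℕ} {E : Type*} [MeasurableSpace E] (μ : Measure E)
    [SigmaFinite μ] (f : E → ℝ≥0∞) (hf : Measurable f) [SigmaFinite (μ.withDensity f)] :
    (Measure.pi fun _ : Fin n => μ.withDensity f) =
      (Measure.pi fun _ => μ).withDensity fun x => ∏ i, f (x i) := by
  refine Measure.pi_eq fun s hs => ?_
  rw [withDensity_apply _ (MeasurableSet.univ_pi hs), ← lintegral_indicator (MeasurableSet.univ_pi hs)]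
  have : ∀ x : Fin n → E, (Set.univ.pi s).indicator (fun x => ∏ i, f (x i)) x =
      ∏ i, (s i).indicator f (x i) := by
    intro x
    by_cases hx : x ∈ Set.univ.pi s
    · rw [Set.indicator_of_mem hx]
      exact Finset.prod_congr rfl fun i _ => (Set.indicator_of_mem (hx i trivial) _).symm
    · rw [Set.indicator_of_notMem hx]
      obtain ⟨i, hi⟩ : ∃ i, x i ∉ s i := by simpa using hx
      exact (Finset.prod_eq_zero (Finset.mem_univ i) (Set.indicator_of_notMem hi _)).symm
  simp_rw [this]
  rw [lintegral_pi_prod_eq_prod μ (fun i => (s i).indicator f) fun i => hf.indicator (hs i)]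
  exact Finset.prod_congr rfl fun i _ => by
    rw [lintegral_indicator (hs i), withDensity_apply _ (hs i)]

section Law

variable {d K T : ℕ} {P : Measure (Obs d K)} {p₀ : VecFun d K}

theorem measurable_uncurry_apply {X : Type*} [MeasurableSpace X] {f : X → Fin K → ℝ}
    (hf : Measurable f) : Measurable fun x : X × Fin K => f x.1 x.2 :=
  measurable_from_prod_countable_left fun k => (measurable_pi_apply k).comp hf

variable [IsProbabilityMeasure P]

/-- A set of observations is the disjoint union of its slices over the classes, where `cond`
applies. The resulting product density of the data turns conditioning on the prompts into a finite
weighted sum over label sequences. -/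
theorem IsTrueClassProb.eq_withDensity (h : IsTrueClassProb P p₀) :
    P = (P.fst.prod Measure.count).withDensity fun x => ENNReal.ofReal (p₀ x.1 x.2) := by
  have hm : Measurable fun x : Obs d K => ENNReal.ofReal (p₀ x.1 x.2) :=
    (measurable_uncurry_apply h.measurable).ennreal_ofReal
  ext s hs
  have hA : ∀ k, MeasurableSet ((fun z : Prompt d => (z, k)) ⁻¹' s) := fun k =>
    measurable_prodMk_right hs
  have hU : s = ⋃ k : Fin K, ((fun z : Prompt d => (z, k)) ⁻¹' s) ×ˢ {k} := by
    ext ⟨z, k⟩; simp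
  have hd : Pairwise (Function.onFun Disjoint
      fun k : Fin K => ((fun z : Prompt d => (z, k)) ⁻¹' s) ×ˢ ({k} : Set (Fin K))) := by
    intro i j hij
    exact Set.disjoint_prod.2 (Or.inr (by simpa using hij))
  rw [hU, measure_iUnion hd fun k => (hA k).prod (measurableSet_singleton k),
    measure_iUnion hd fun k => (hA k).prod (measurableSet_singleton k)]
  refine tsum_congr fun k => ?_
  rw [h.cond k _ (hA k), withDensity_apply _ ((hA k).prod (measurableSet_singleton k)),
    ← Measure.prod_restrict, lintegral_prod _ hm.aemeasurable]
  simp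

theorem IsTrueClassProb.dataLaw_eq (h : IsTrueClassProb P p₀) :
    dataLaw P T = (Measure.pi fun _ : Fin T => P.fst.prod Measure.count).withDensity
      fun D => ∏ t, ENNReal.ofReal (p₀ (D t).1 (D t).2) := by
  have hm : Measurable fun x : Obs d K => ENNReal.ofReal (p₀ x.1 x.2) :=
    (measurable_uncurry_apply h.measurable).ennreal_ofReal
  have : SigmaFinite ((P.fst.prod Measure.count).withDensity
      fun x : Obs d K => ENNReal.ofReal (p₀ x.1 x.2)) := by
    rw [← h.eq_withDensity]; infer_instance
  rw [← pi_withDensity (P.fst.prod Measure.count) _ hm, ← h.eq_withDensity, dataLaw]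

/-- A bound of the conditional expectations given the prompts bounds the expectation. -/
theorem IsTrueClassProb.integral_dataLaw_le (h : IsTrueClassProb P p₀)
    (hcube : ∀ᵐ z ∂P.fst, z ∈ cube d) {f : Data d K T → ℝ} (hf : Integrable f (dataLaw P T))
    {b : ℝ} (hb : ∀ z : Fin T → Prompt d, (∀ t, z t ∈ cube d) →
      ∑ c : Fin T → Fin K, (∏ t, p₀ (z t) (c t)) * f (fun t => (z t, c t)) ≤ b) :
    ∫ D, f D ∂(dataLaw P T) ≤ b := by
  have hm : Measurable fun D : Data d K T => ∏ t, ENNReal.ofReal (p₀ (D t).1 (D t).2) :=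
    Finset.measurable_prod _ fun t _ =>
      ((measurable_uncurry_apply h.measurable).comp (measurable_pi_apply t)).ennreal_ofReal
  have hfin : ∀ D : Data d K T, ∏ t, ENNReal.ofReal (p₀ (D t).1 (D t).2) < ∞ := fun D =>
    ENNReal.prod_lt_top fun _ _ => ENNReal.ofReal_lt_top
  -- Regroups the data into a prompt sequence and a label sequence, so that Fubini integrates the
  -- labels first.
  have hmp := (measurePreserving_arrowProdEquivProdArrow (Prompt d) (Fin K) (Fin T)
    (fun _ => P.fst) (fun _ => Measure.count)).symm
  rw [h.dataLaw_eq] at hf ⊢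
  rw [integrable_withDensity_iff_integrable_smul' hm (Filter.Eventually.of_forall hfin)] at hf
  have hint := (hmp.integrable_comp_emb (MeasurableEquiv.measurableEmbedding _)).2 hf
  rw [integral_withDensity_eq_integral_toReal_smul hm (Filter.Eventually.of_forall hfin),
    ← hmp.integral_comp (MeasurableEquiv.measurableEmbedding _)]
  refine le_trans (integral_prod _ hint).le ?_
  have hae : ∀ᵐ z ∂(Measure.pi fun _ : Fin T => P.fst), ∀ t, z t ∈ cube d :=
    ae_all_iff.2 fun t =>
      (measurePreserving_eval (fun _ : Fin T => P.fst) t).quasiMeasurePreserving.ae hcube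
  calc _ ≤ ∫ z, b ∂(Measure.pi fun _ : Fin T => P.fst) := by
        refine integral_mono_ae hint.integral_prod_left (integrable_const b) (hae.mono fun z hz => ?_)
        refine le_trans (le_of_eq ?_) (hb z hz)
        dsimp only
        rw [integral_fintype (Integrable.of_finite)]
        refine Finset.sum_congr rfl fun c _ => ?_
        have h1 : (Measure.pi fun _ : Fin T => (Measure.count : Measure (Fin K))).real {c} = 1 := by
          simp [measureReal_def]
        rw [h1, one_smul]
        change (∏ t, ENNReal.ofReal (p₀ (z t) (c t))).toReal * f (fun t => (z t, c t)) = _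
        rw [ENNReal.toReal_prod]
        congr 1
        exact Finset.prod_congr rfl fun t _ => ENNReal.toReal_ofReal ((h.classProb _ (hz t)).1 _)
    _ = b := by simp

theorem IsTrueClassProb.lintegral_eq (h : IsTrueClassProb P p₀) {f : Obs d K → ℝ≥0∞}
    (hf : Measurable f) :
    ∫⁻ x, f x ∂P = ∫⁻ z, ∑ k, ENNReal.ofReal (p₀ z k) * f (z, k) ∂P.fst := by
  have hm : Measurable fun x : Obs d K => ENNReal.ofReal (p₀ x.1 x.2) :=
    (measurable_uncurry_apply h.measurable).ennreal_ofReal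
  conv_lhs => rw [h.eq_withDensity]
  rw [lintegral_withDensity_eq_lintegral_mul _ hm hf, lintegral_prod _ (hm.mul hf).aemeasurable]
  simp [lintegral_count, tsum_fintype]

theorem IsTrueClassProb.integral_eq (h : IsTrueClassProb P p₀)
    (hcube : ∀ᵐ z ∂P.fst, z ∈ cube d) {f : Obs d K → ℝ} (hf : Integrable f P) :
    Integrable (fun z => ∑ k, p₀ z k * f (z, k)) P.fst ∧
    ∫ x, f x ∂P = ∫ z, ∑ k, p₀ z k * f (z, k) ∂P.fst := by
  have hm : Measurable fun x : Obs d K => ENNReal.ofReal (p₀ x.1 x.2) :=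
    (measurable_uncurry_apply h.measurable).ennreal_ofReal
  have hfin : ∀ᵐ x ∂(P.fst.prod (Measure.count : Measure (Fin K))),
      ENNReal.ofReal (p₀ x.1 x.2) < ∞ := Filter.Eventually.of_forall fun x => ENNReal.ofReal_lt_top
  have hf' := hf
  rw [h.eq_withDensity, integrable_withDensity_iff_integrable_smul' hm hfin] at hf'
  have hae : (fun z => ∑ k, p₀ z k * f (z, k)) =ᵐ[P.fst]
      fun z => ∫ k, (ENNReal.ofReal (p₀ z k)).toReal • f (z, k) ∂Measure.count := by
    filter_upwards [hcube] with z hz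
    rw [integral_fintype (Integrable.of_finite)]
    refine Finset.sum_congr rfl fun k _ => ?_
    simp [measureReal_def, ENNReal.toReal_ofReal ((h.classProb _ hz).1 k)]
  refine ⟨hf'.integral_prod_left.congr hae.symm, ?_⟩
  conv_lhs => rw [h.eq_withDensity]
  rw [integral_withDensity_eq_integral_toReal_smul hm hfin, integral_prod _ hf']
  exact integral_congr_ae hae.symm

end Law

/-! ### Finite nets and the bounds for fixed prompts -/

section Net

variable {d K T : ℕ} {F : Set (VecFun d K)}

/-- A finite covering number yields a finite net inside the class. -/
theorem exists_finset_net {δ : ℝ≥0} {N : ℕ}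
    (hN : unifCoveringNumber δ (logClass F) T ≤ N) (z : Fin T → Prompt d) :
    ∃ G : Finset (VecFun d K), (G.card : ℝ) ≤ N ∧ (∀ q ∈ G, q ∈ F) ∧
      ∀ p ∈ F, ∃ q ∈ G, ∀ t k, |Real.log (p (z t) k) - Real.log (q (z t) k)| ≤ 2 * δ := by
  let _ : PseudoEMetricSpace (VecFun d K) := empMetric z
  -- Moving the centres into the class doubles the radius; they must lie in `F` for the exponential
  -- moment bounds to apply to them.
  have h1 : Metric.coveringNumber (2 * δ) (logClass F) ≤ N :=
    (Metric.coveringNumber_two_mul_le_externalCoveringNumber δ (logClass F)).trans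
      ((le_iSup (fun z => empCoveringNumber δ (logClass F) z) z).trans hN)
  have h2 : Metric.coveringNumber (2 * δ) (logClass F) ≠ ⊤ :=
    (h1.trans_lt (ENat.natCast_lt_top N)).ne
  obtain ⟨C, hCF, hCfin, hCcov, hCcard⟩ := Metric.exists_set_encard_eq_coveringNumber h2
  rw [isCover_empMetric_iff] at hCcov
  choose! g hgF hg using fun f (hf : f ∈ logClass F) => hf
  classical
  refine ⟨hCfin.toFinset.image g, ?_, ?_, ?_⟩
  · have h3 : hCfin.toFinset.card ≤ N := by
      rw [← hCcard, hCfin.encard_eq_coe_toFinset_card] at h1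
      exact_mod_cast h1
    exact_mod_cast Finset.card_image_le.trans h3
  · intro q hq
    obtain ⟨f, hf, rfl⟩ := Finset.mem_image.1 hq
    exact hgF f (hCF (hCfin.mem_toFinset.1 hf))
  · intro p hp
    obtain ⟨f, hfC, hf⟩ := hCcov _ ⟨p, hp, rfl⟩
    refine ⟨g f, Finset.mem_image_of_mem g (hCfin.mem_toFinset.2 hfC), fun t k => ?_⟩
    have h4 := hf t k
    rw [← hg f (hCF hfC)] at h4
    simpa using h4

end Net

section Fixed

variable {d K T : ℕ} {F : Set (VecFun d K)} {p₀ : VecFun d K} {B M : ℝ}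

/-- The truncated log-likelihood ratio at an observation. -/
noncomputable def truncLogRatio (B : ℝ) (p₀ p : VecFun d K) (x : Obs d K) : ℝ :=
  min B (Real.log (p₀ x.1 x.2 / p x.1 x.2))

/-- By independence the exponential moment factors over the coordinates. -/
theorem sum_prod_mul_exp_sum_le_one {q : Fin T → Fin K → ℝ} {a : Fin T → Fin K → ℝ}
    (hq : ∀ t k, 0 ≤ q t k) (h : ∀ t, ∑ k, q t k * Real.exp (a t k) ≤ 1) :
    ∑ c : Fin T → Fin K, (∏ t, q t (c t)) * Real.exp (∑ t, a t (c t)) ≤ 1 := by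
  classical
  simp_rw [Real.exp_sum, ← Finset.prod_mul_distrib]
  rw [← Fintype.prod_sum (fun t k => q t k * Real.exp (a t k))]
  exact Finset.prod_le_one (fun t _ => Finset.sum_nonneg fun k _ =>
    mul_nonneg (hq t k) (Real.exp_pos _).le) fun t _ => h t

theorem sum_prod_eq_one {q : Fin T → Fin K → ℝ} (hq : ∀ t, ∑ k, q t k = 1) :
    ∑ c : Fin T → Fin K, ∏ t, q t (c t) = 1 := by
  classical
  rw [← Fintype.prod_sum]
  exact Finset.prod_eq_one fun t _ => hq t

/-- The conditional bound given the prompts: the truncated divergences at the prompts are controlled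
by the truncated log-likelihood ratios at the observations. -/
theorem sum_truncKL_sub_truncLogRatio_le (hB : 2 ≤ B) (hT : 0 < T) (hM : 0 < M)
    (hp₀ : IsClassProb p₀) (hF : ∀ p ∈ F, IsClassProb p)
    (hpos : ∀ p ∈ F, ∀ z ∈ cube d, ∀ k, 0 < p z k)
    {z : Fin T → Prompt d} (hz : ∀ t, z t ∈ cube d) {G : Finset (VecFun d K)}
    (hcard : (G.card : ℝ) ≤ M) (hGF : ∀ q ∈ G, q ∈ F)
    (hG : ∀ p ∈ F, ∃ q ∈ G, ∀ t k, |Real.log (p (z t) k) - Real.log (q (z t) k)| ≤ 2 / T)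
    (φ : (Fin T → Fin K) → VecFun d K) (hφ : ∀ c, φ c ∈ F) :
    ∑ c : Fin T → Fin K, (∏ t, p₀ (z t) (c t)) * ∑ t, (truncKL B (p₀ (z t)) (φ c (z t)) / 2 -
      truncLogRatio B p₀ (φ c) (z t, c t)) ≤ 3 + 2 * B * Real.log M := by
  have hB0 : 0 < B := by linarith
  have hT0 : (0 : ℝ) < T := by exact_mod_cast hT
  -- `φ c` depends on the labels, the net only on the prompts. Replacing `φ c` by a net point costs
  -- `1/T` in the half-divergence and `2/T` in the ratio, per task: 3 in all, before division by
  -- `2B`.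
  have key := sum_weight_mul_le_add_log (ι := G) (fun c : Fin T → Fin K => ∏ t, p₀ (z t) (c t))
    (fun c => Finset.prod_nonneg fun t _ => (hp₀ _ (hz t)).1 _)
    (sum_prod_eq_one fun t => (hp₀ _ (hz t)).2)
    (fun q c => ∑ t, (truncKL B (p₀ (z t)) (q.1 (z t)) / (4 * B) -
      truncLogRatio B p₀ q.1 (z t, c t) / (2 * B)))
    (fun c => (∑ t, (truncKL B (p₀ (z t)) (φ c (z t)) / 2 -
      truncLogRatio B p₀ (φ c) (z t, c t))) / (2 * B)) (3 / (2 * B)) M hM (by simpa using hcard)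
    ?_ ?_
  · simp_rw [← mul_div_assoc, ← Finset.sum_div] at key
    rw [div_le_iff₀ (by positivity)] at key
    refine key.trans (le_of_eq ?_)
    field_simp
  · intro q
    refine sum_prod_mul_exp_sum_le_one (q := fun t k => p₀ (z t) k)
      (a := fun t k => truncKL B (p₀ (z t)) (q.1 (z t)) / (4 * B) -
      truncLogRatio B p₀ q.1 (z t, k) / (2 * B)) (fun t k => (hp₀ _ (hz t)).1 k) fun t => ?_
    have h1 := sum_mul_exp_neg_min_log_le hB (hp₀ _ (hz t)) (hF _ (hGF _ q.2) _ (hz t))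
      (hpos _ (hGF _ q.2) _ (hz t))
    simp_rw [sub_eq_add_neg, Real.exp_add, mul_left_comm (p₀ _ _), ← Finset.mul_sum]
    set κ := truncKL B (p₀ (z t)) (q.1 (z t)) / (4 * B)
    calc _ ≤ Real.exp κ * Real.exp (-κ) :=
          mul_le_mul_of_nonneg_left (h1.trans (by linarith [Real.add_one_le_exp (-κ)]))
            (Real.exp_pos _).le
      _ = 1 := by rw [← Real.exp_add]; simp
  · intro c
    obtain ⟨q, hqG, hq⟩ := hG _ (hφ c)
    refine ⟨⟨q, hqG⟩, ?_⟩
    have h1 : ∀ t, truncKL B (p₀ (z t)) (φ c (z t)) / 2 - truncLogRatio B p₀ (φ c) (z t, c t) ≤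
        truncKL B (p₀ (z t)) (q (z t)) / 2 - truncLogRatio B p₀ q (z t, c t) + 3 / T := by
      intro t
      have h2 := truncKL_le_add (B := B) (hp₀ _ (hz t)) (hpos _ (hφ c) _ (hz t))
        (hpos _ (hGF _ hqG) _ (hz t)) (hq t)
      have h3 := min_log_div_le_add (B := B) (e := 2 / T) ((hp₀ _ (hz t)).1 (c t))
        (hpos _ (hGF _ hqG) _ (hz t) (c t)) (hpos _ (hφ c) _ (hz t) (c t))
        (by rw [abs_sub_comm]; exact hq t (c t))
      simp only [truncLogRatio]
      have : (3 : ℝ) / T = 2 / T / 2 + 2 / T := by ring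
      linarith
    have h4 := Finset.sum_le_sum fun t (_ : t ∈ Finset.univ) => h1 t
    rw [Finset.sum_add_distrib, Finset.sum_const, Finset.card_univ, Fintype.card_fin, nsmul_eq_mul,
      mul_div_cancel₀ _ hT0.ne'] at h4
    have h5 : ∑ t, (truncKL B (p₀ (z t)) (q (z t)) / (4 * B) -
        truncLogRatio B p₀ q (z t, c t) / (2 * B)) =
        (∑ t, (truncKL B (p₀ (z t)) (q (z t)) / 2 - truncLogRatio B p₀ q (z t, c t))) / (2 * B) := by
      rw [Finset.sum_div]
      exact Finset.sum_congr rfl fun t _ => by field_simp; ring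
    dsimp only
    rw [h5, ← add_div]
    exact div_le_div_of_nonneg_right (by linarith) (by positivity)

/-- The symmetrized bound: exchanging the prompts of two samples at random, the divergences on the
second sample are controlled by those on the first. -/
theorem sum_swap_truncKL_le (hB : 2 ≤ B) (hT : 0 < T) (hM : 0 < M)
    (hp₀ : IsClassProb p₀) (hF : ∀ p ∈ F, IsClassProb p)
    (hpos : ∀ p ∈ F, ∀ z ∈ cube d, ∀ k, 0 < p z k)
    {z z' : Fin T → Prompt d} (hz : ∀ t, z t ∈ cube d) (hz' : ∀ t, z' t ∈ cube d)
    {G G' : Finset (VecFun d K)}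
    (hcard : (G.card : ℝ) ≤ M) (hGF : ∀ q ∈ G, q ∈ F)
    (hG : ∀ p ∈ F, ∃ q ∈ G, ∀ t k, |Real.log (p (z t) k) - Real.log (q (z t) k)| ≤ 2 / T)
    (hcard' : (G'.card : ℝ) ≤ M) (hGF' : ∀ q ∈ G', q ∈ F)
    (hG' : ∀ p ∈ F, ∃ q ∈ G', ∀ t k, |Real.log (p (z' t) k) - Real.log (q (z' t) k)| ≤ 2 / T)
    (φ : (Fin T → Fin 2) → VecFun d K) (hφ : ∀ σ, φ σ ∈ F) :
    ∑ σ : Fin T → Fin 2, (∏ _t : Fin T, (1 / 2 : ℝ)) *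
      ∑ t, (truncKL B (p₀ (if σ t = 0 then z' t else z t)) (φ σ (if σ t = 0 then z' t else z t)) -
        3 * truncKL B (p₀ (if σ t = 0 then z t else z' t)) (φ σ (if σ t = 0 then z t else z' t))) ≤
      8 + 4 * B * Real.log M := by
  have hB0 : 0 < B := by linarith
  have hT0 : (0 : ℝ) < T := by exact_mod_cast hT
  let κ : VecFun d K → Prompt d → ℝ := fun p z => truncKL B (p₀ z) (p z)
  -- Covers are controlled at `T` points only, so `q` approximates at the points `z` and `q'` at the
  -- points `z'`. The index set `G × G'` has at most `M²` elements, which doubles `log M`.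
  let f : VecFun d K → VecFun d K → Fin T → Fin 2 → ℝ := fun q q' t s =>
    if s = 0 then κ q' (z' t) - 3 * κ q (z t) else κ q (z t) - 3 * κ q' (z' t)
  have hf : ∀ p t s, truncKL B (p₀ (if s = 0 then z' t else z t)) (p (if s = 0 then z' t else z t)) -
        3 * truncKL B (p₀ (if s = 0 then z t else z' t)) (p (if s = 0 then z t else z' t)) =
      f p p t s := by
    intro p t s
    simp only [f, κ]
    split_ifs <;> rfl
  simp_rw [hf]
  have key := sum_weight_mul_le_add_log (ι := G × G') (fun σ : Fin T → Fin 2 => ∏ _t, (1 / 2 : ℝ))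
    (fun σ => Finset.prod_nonneg fun t _ => by norm_num)
    (sum_prod_eq_one (q := fun _ _ => 1 / 2) fun t => by norm_num)
    (fun q σ => ∑ t, f q.1.1 q.2.1 t (σ t) / (2 * B))
    (fun σ => (∑ t, f (φ σ) (φ σ) t (σ t)) / (2 * B)) (8 / (2 * B)) (M * M) (by positivity)
    (by
      rw [Fintype.card_prod, Nat.cast_mul]
      exact mul_le_mul (by simpa using hcard) (by simpa using hcard') (Nat.cast_nonneg _) hM.le)
    ?_ ?_
  · simp_rw [← mul_div_assoc, ← Finset.sum_div] at key
    rw [div_le_iff₀ (by positivity), Real.log_mul hM.ne' hM.ne'] at key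
    refine key.trans (le_of_eq ?_)
    field_simp
    ring
  · rintro ⟨⟨q, hq⟩, ⟨q', hq'⟩⟩
    refine sum_prod_mul_exp_sum_le_one (q := fun _ _ => 1 / 2)
      (a := fun t s => f q q' t s / (2 * B)) (fun t k => by norm_num) fun t => ?_
    have h0 : ∀ p ∈ F, ∀ y ∈ cube d, 0 ≤ κ p y / (2 * B) ∧ κ p y / (2 * B) ≤ 1 / 2 := by
      intro p hp y hy
      refine ⟨div_nonneg (truncKL_nonneg hB (hp₀ _ hy) (hF _ hp _ hy) (hpos _ hp _ hy))
        (by positivity), ?_⟩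
      rw [div_le_div_iff₀ (by positivity) (by norm_num)]
      linarith [truncKL_le (B := B) (r := p y) (hp₀ _ hy)]
    obtain ⟨h1, h2⟩ := h0 q (hGF _ hq) _ (hz t)
    obtain ⟨h3, h4⟩ := h0 q' (hGF' _ hq') _ (hz' t)
    have h5 := exp_add_exp_le_two h1 h3 h2 h4
    rw [Fin.sum_univ_two]
    simp only [f, if_true, one_ne_zero, if_false, sub_div, mul_div_assoc]
    linarith
  · intro σ
    obtain ⟨q, hqG, hq⟩ := hG _ (hφ σ)
    obtain ⟨q', hqG', hq'⟩ := hG' _ (hφ σ)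
    refine ⟨⟨⟨q, hqG⟩, ⟨q', hqG'⟩⟩, ?_⟩
    -- The coefficients 1 and 3 each carry an error of `2/T`.
    have h1 : ∀ t s, f (φ σ) (φ σ) t s ≤ f q q' t s + 8 / T := by
      intro t s
      have e1 : κ (φ σ) (z t) ≤ κ q (z t) + 2 / T := truncKL_le_add (hp₀ _ (hz t))
        (hpos _ (hφ σ) _ (hz t)) (hpos _ (hGF _ hqG) _ (hz t)) (hq t)
      have e2 : κ q (z t) ≤ κ (φ σ) (z t) + 2 / T := truncKL_le_add (hp₀ _ (hz t))
        (hpos _ (hGF _ hqG) _ (hz t)) (hpos _ (hφ σ) _ (hz t))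
        (fun k => by rw [abs_sub_comm]; exact hq t k)
      have e3 : κ (φ σ) (z' t) ≤ κ q' (z' t) + 2 / T := truncKL_le_add (hp₀ _ (hz' t))
        (hpos _ (hφ σ) _ (hz' t)) (hpos _ (hGF' _ hqG') _ (hz' t)) (hq' t)
      have e4 : κ q' (z' t) ≤ κ (φ σ) (z' t) + 2 / T := truncKL_le_add (hp₀ _ (hz' t))
        (hpos _ (hGF' _ hqG') _ (hz' t)) (hpos _ (hφ σ) _ (hz' t))
        (fun k => by rw [abs_sub_comm]; exact hq' t k)
      have : (8 : ℝ) / T = 4 * (2 / T) := by ring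
      simp only [f]
      split_ifs <;> linarith
    have h4 := Finset.sum_le_sum fun t (_ : t ∈ Finset.univ) => h1 t (σ t)
    rw [Finset.sum_add_distrib, Finset.sum_const, Finset.card_univ, Fintype.card_fin, nsmul_eq_mul,
      mul_div_cancel₀ _ hT0.ne'] at h4
    dsimp only
    rw [← Finset.sum_div, ← add_div]
    exact div_le_div_of_nonneg_right h4 (by positivity)

end Fixed

/-! ### Integrability -/

section Integrability

variable {d K T : ℕ} {P : Measure (Obs d K)} {p₀ : VecFun d K}
  {F : Set (VecFun d K)} {B : ℝ}

theorem measurable_apply_apply {X : Type*} [MeasurableSpace X] {f : X → Fin K → ℝ} {k : X → Fin K}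
    (hf : Measurable f) (hk : Measurable k) : Measurable fun x => f x (k x) :=
  (measurable_uncurry_apply (X := X) hf).comp (measurable_id.prodMk hk)

theorem measurable_truncKL {X : Type*} [MeasurableSpace X] {f g : X → Fin K → ℝ}
    (hf : Measurable f) (hg : Measurable g) : Measurable fun x => truncKL B (f x) (g x) := by
  refine Finset.measurable_sum _ fun k _ => ?_
  have hf' : Measurable fun x => f x k := (measurable_pi_apply k).comp hf
  have hg' : Measurable fun x => g x k := (measurable_pi_apply k).comp hg
  exact hf'.mul (measurable_const.min (hf'.div hg').log)

theorem ae_fst_mem_cube (hcube : ∀ᵐ z ∂P.fst, z ∈ cube d) : ∀ᵐ x ∂P, x.1 ∈ cube d :=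
  ae_of_ae_map measurable_fst.aemeasurable hcube

theorem integrable_truncKL_comp {phat : Data d K T → VecFun d K} {Ω : Type*}
    [MeasurableSpace Ω] {μ : Measure Ω} [IsFiniteMeasure μ]
    (h : IsTrueClassProb P p₀) (hB : 2 ≤ B) (hF : ∀ p ∈ F, IsClassProb p)
    (hpos : ∀ p ∈ F, ∀ z ∈ cube d, ∀ k, 0 < p z k) (hphat : ∀ D, phat D ∈ F)
    (hmeas : Measurable fun x : Data d K T × Prompt d => phat x.1 x.2)
    {D : Ω → Data d K T} {z : Ω → Prompt d} (hD : Measurable D) (hz : Measurable z)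
    (hzc : ∀ᵐ ω ∂μ, z ω ∈ cube d) :
    Integrable (fun ω => truncKL B (p₀ (z ω)) (phat (D ω) (z ω))) μ := by
  refine (integrable_const B).mono' (measurable_truncKL (h.measurable.comp hz)
    (hmeas.comp (hD.prodMk hz))).aestronglyMeasurable (hzc.mono fun ω hω => ?_)
  rw [Real.norm_eq_abs, abs_of_nonneg (truncKL_nonneg hB (h.classProb _ hω)
    (hF _ (hphat _) _ hω) (hpos _ (hphat _) _ hω))]
  exact truncKL_le (h.classProb _ hω)

variable [IsProbabilityMeasure P]

theorem IsTrueClassProb.ae_pos (h : IsTrueClassProb P p₀) : ∀ᵐ x ∂P, 0 < p₀ x.1 x.2 := by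
  have hm : Measurable fun x : Obs d K => ENNReal.ofReal (p₀ x.1 x.2) :=
    (measurable_uncurry_apply h.measurable).ennreal_ofReal
  rw [h.eq_withDensity, ae_withDensity_iff hm]
  exact Filter.Eventually.of_forall fun x hx => by simpa using hx

theorem ae_dataLaw_of_ae {s : Obs d K → Prop} (h : ∀ᵐ x ∂P, s x) :
    ∀ᵐ D ∂(dataLaw P T), ∀ t, s (D t) :=
  ae_all_iff.2 fun t =>
    (measurePreserving_eval (fun _ : Fin T => P) t).quasiMeasurePreserving.ae h

instance isProbabilityMeasure_dataLaw : IsProbabilityMeasure (dataLaw P T) := by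
  unfold dataLaw; infer_instance

theorem integrable_sum_dataLaw {f : Obs d K → ℝ} (hf : Integrable f P) :
    Integrable (fun D : Data d K T => ∑ t, f (D t)) (dataLaw P T) :=
  integrable_finsetSum _ fun t _ =>
    ((measurePreserving_eval (fun _ : Fin T => P) t).integrable_comp hf.aestronglyMeasurable).2 hf

theorem integral_sum_dataLaw {f : Obs d K → ℝ} (hf : Integrable f P) :
    ∫ D : Data d K T, ∑ t, f (D t) ∂(dataLaw P T) = T * ∫ x, f x ∂P := by
  have hi : ∀ t, Integrable (fun D : Data d K T => f (D t)) (dataLaw P T) := fun t =>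
    ((measurePreserving_eval (fun _ : Fin T => P) t).integrable_comp hf.aestronglyMeasurable).2 hf
  rw [integral_finsetSum _ fun t _ => hi t]
  have : ∀ t, ∫ D : Data d K T, f (D t) ∂(dataLaw P T) = ∫ x, f x ∂P := fun t =>
    integral_comp_eval (μ := fun _ : Fin T => P) hf.aestronglyMeasurable
  simp [this]

/-- `a |log a| ≤ 1` on `(0, 1]`, so the conditional expectation given the prompt is at most `K`. -/
theorem IsTrueClassProb.integrable_log (h : IsTrueClassProb P p₀)
    (hcube : ∀ᵐ z ∂P.fst, z ∈ cube d) : Integrable (fun x => Real.log (p₀ x.1 x.2)) P := by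
  have hm : Measurable fun x : Obs d K => Real.log (p₀ x.1 x.2) :=
    (measurable_uncurry_apply h.measurable).log
  refine ⟨hm.aestronglyMeasurable, ?_⟩
  rw [HasFiniteIntegral, h.lintegral_eq hm.enorm]
  calc _ ≤ ∫⁻ _, (K : ℝ≥0∞) ∂P.fst := by
        refine lintegral_mono_ae (hcube.mono fun z hz => ?_)
        have h1 : ∀ k ∈ Finset.univ, ENNReal.ofReal (p₀ z k) * ‖Real.log (p₀ z k)‖ₑ ≤ 1 := by
          intro k _
          have hs := h.classProb z hz
          rcases (hs.1 k).eq_or_lt with h0 | h0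
          · simp [← h0]
          · have hle : p₀ z k ≤ 1 := hs.2 ▸ Finset.single_le_sum (fun i _ => hs.1 i)
              (Finset.mem_univ k)
            have := Real.abs_log_mul_self_lt _ h0 hle
            rw [← ofReal_norm, ← ENNReal.ofReal_mul (hs.1 k), Real.norm_eq_abs]
            refine ENNReal.ofReal_le_one.2 ?_
            rw [abs_mul, abs_of_pos h0] at this
            linarith
        simpa using Finset.sum_le_sum h1
    _ < ∞ := by simp

theorem stdSimplex_le_one {q : Fin K → ℝ} (hq : q ∈ stdSimplex ℝ (Fin K)) (k : Fin K) : q k ≤ 1 :=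
  hq.2 ▸ Finset.single_le_sum (fun i _ => hq.1 i) (Finset.mem_univ k)

/-- Since `log p ≤ 0`, the ratio is at least `log p₀`. The envelope does not depend on `p`, so it
serves an estimator varying with the data. -/
theorem abs_truncLogRatio_le (hB : 0 ≤ B) {p : VecFun d K} {x : Obs d K} (h0 : 0 < p₀ x.1 x.2)
    (hp : 0 < p x.1 x.2) (hp1 : p x.1 x.2 ≤ 1) :
    |truncLogRatio B p₀ p x| ≤ B + |Real.log (p₀ x.1 x.2)| := by
  have h1 := Real.log_nonpos hp.le hp1
  rw [truncLogRatio, Real.log_div h0.ne' hp.ne', abs_le]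
  have h2 := neg_abs_le (Real.log (p₀ x.1 x.2))
  have h3 := abs_nonneg (Real.log (p₀ x.1 x.2))
  exact ⟨le_min (by linarith) (by linarith), (min_le_left _ _).trans (by linarith)⟩

section Estimator

variable {phat : Data d K T → VecFun d K}

theorem measurable_eval_estimator (hmeas : Measurable fun x : Data d K T × Prompt d => phat x.1 x.2)
    (t : Fin T) : Measurable fun D => phat D (D t).1 :=
  hmeas.comp (measurable_id.prodMk (measurable_fst.comp (measurable_pi_apply t)))

theorem integrable_truncLogRatio (h : IsTrueClassProb P p₀) (hcube : ∀ᵐ z ∂P.fst, z ∈ cube d)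
    (hB : 0 ≤ B) (hF : ∀ p ∈ F, IsClassProb p) (hpos : ∀ p ∈ F, ∀ z ∈ cube d, ∀ k, 0 < p z k)
    (hphat : ∀ D, phat D ∈ F)
    (hmeas : Measurable fun x : Data d K T × Prompt d => phat x.1 x.2) (t : Fin T) :
    Integrable (fun D => truncLogRatio B p₀ (phat D) (D t)) (dataLaw P T) := by
  have h1 : Integrable (fun D : Data d K T => B + |Real.log (p₀ (D t).1 (D t).2)|) (dataLaw P T) :=
    (integrable_const B).add (((measurePreserving_eval (fun _ : Fin T => P) t).integrable_comp
      (h.integrable_log hcube).aestronglyMeasurable).2 (h.integrable_log hcube)).abs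
  have hk : Measurable fun D : Data d K T => (D t).2 := measurable_snd.comp (measurable_pi_apply t)
  have hm : Measurable fun D => truncLogRatio B p₀ (phat D) (D t) :=
    measurable_const.min ((measurable_apply_apply (h.measurable.comp
      (measurable_fst.comp (measurable_pi_apply t))) hk).div
      (measurable_apply_apply (measurable_eval_estimator hmeas t) hk)).log
  refine h1.mono' hm.aestronglyMeasurable ?_
  filter_upwards [ae_dataLaw_of_ae h.ae_pos, ae_dataLaw_of_ae (ae_fst_mem_cube hcube)] with D h2 h3
  exact abs_truncLogRatio_le hB (h2 t) (hpos _ (hphat D) _ (h3 t) _)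
    (stdSimplex_le_one (hF _ (hphat D) _ (h3 t)) _)

end Estimator

end Integrability

/-! ### The likelihood step -/

section Likelihood

variable {d K T : ℕ} {P : Measure (Obs d K)} [IsProbabilityMeasure P] {p₀ : VecFun d K}
  {F : Set (VecFun d K)} {B : ℝ} {phat : Data d K T → VecFun d K}

theorem empRisk_eq (D : Data d K T) (p : VecFun d K) :
    empRisk D p = -(∑ t, Real.log (p (D t).1 (D t).2)) / T := by
  simp only [empRisk, oneHot, Pi.single_apply, ite_mul, one_mul, zero_mul, Finset.sum_ite_eq',
    Finset.mem_univ, if_true]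
  ring

theorem ofReal_integral_le_lintegral {Ω : Type*} [MeasurableSpace Ω] {μ : Measure Ω} {f : Ω → ℝ}
    (hf : Integrable f μ) : ENNReal.ofReal (∫ ω, f ω ∂μ) ≤ ∫⁻ ω, ENNReal.ofReal (f ω) ∂μ := by
  rw [integral_eq_lintegral_pos_part_sub_lintegral_neg_part hf]
  exact (ENNReal.ofReal_le_ofReal (sub_le_self _ ENNReal.toReal_nonneg)).trans
    ENNReal.ofReal_toReal_le

theorem integrable_log_div (h : IsTrueClassProb P p₀) (hcube : ∀ᵐ z ∂P.fst, z ∈ cube d)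
    {p : VecFun d K} (hpm : Measurable p) (hp : IsClassProb p) {a : ℝ} (ha : 0 < a)
    (hpa : ∀ z ∈ cube d, ∀ k, a ≤ p z k) :
    Integrable (fun x : Obs d K => Real.log (p₀ x.1 x.2 / p x.1 x.2)) P := by
  refine ((h.integrable_log hcube).abs.add (integrable_const |Real.log a|)).mono'
    ((measurable_uncurry_apply h.measurable).div
      (measurable_uncurry_apply hpm)).log.aestronglyMeasurable ?_
  filter_upwards [h.ae_pos, ae_fst_mem_cube hcube] with x h1 h2
  have h3 := hpa _ h2 x.2
  have h4 := Real.log_nonpos (ha.le.trans h3) (stdSimplex_le_one (hp _ h2) x.2)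
  have h5 := Real.log_le_log ha h3
  rw [Real.log_div h1.ne' (ha.trans_le h3).ne']
  refine (norm_sub_le _ _).trans ?_
  simp only [Real.norm_eq_abs, Pi.add_apply]
  gcongr 1
  rw [abs_of_nonpos h4, abs_of_nonpos (h5.trans h4)]
  linarith

theorem ofReal_integral_log_div_le_risk (h : IsTrueClassProb P p₀)
    (hcube : ∀ᵐ z ∂P.fst, z ∈ cube d) {p : VecFun d K}
    (hint : Integrable (fun x : Obs d K => Real.log (p₀ x.1 x.2 / p x.1 x.2)) P) :
    ENNReal.ofReal (∫ x, Real.log (p₀ x.1 x.2 / p x.1 x.2) ∂P) ≤ risk P p₀ p := by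
  obtain ⟨h1, h2⟩ := h.integral_eq hcube hint
  rw [h2]
  exact ofReal_integral_le_lintegral h1

theorem ofReal_integral_truncLogRatio_le (h : IsTrueClassProb P p₀)
    (hcube : ∀ᵐ z ∂P.fst, z ∈ cube d) (hB : 0 ≤ B) (hF : ∀ p ∈ F, IsClassProb p)
    (hpos : ∀ p ∈ F, ∀ z ∈ cube d, ∀ k, 0 < p z k) (hphat : ∀ D, phat D ∈ F)
    (hmeas : Measurable fun x : Data d K T × Prompt d => phat x.1 x.2) (hT : 0 < T)
    {p : VecFun d K} (hpF : p ∈ F)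
    (hint : Integrable (fun x : Obs d K => Real.log (p₀ x.1 x.2 / p x.1 x.2)) P) :
    ENNReal.ofReal ((∫ D, ∑ t, truncLogRatio B p₀ (phat D) (D t) ∂(dataLaw P T)) / T) ≤
      risk P p₀ p + empGap P F phat := by
  have hT0 : (0 : ℝ) < T := by exact_mod_cast hT
  have hG : Integrable (fun D => ∑ t, truncLogRatio B p₀ (phat D) (D t)) (dataLaw P T) :=
    integrable_finsetSum _ fun t _ => integrable_truncLogRatio h hcube hB hF hpos hphat hmeas t
  have hb : Integrable (fun D : Data d K T => ∑ t, Real.log (p₀ (D t).1 (D t).2 / p (D t).1 (D t).2))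
    (dataLaw P T) := integrable_sum_dataLaw hint
  -- The log-ratio of the comparator `p` is added and subtracted: its mean gives the risk, the
  -- difference the empirical gap.
  have hsplit : (∫ D, ∑ t, truncLogRatio B p₀ (phat D) (D t) ∂(dataLaw P T)) / T =
      ∫ x, Real.log (p₀ x.1 x.2 / p x.1 x.2) ∂P +
      ∫ D, (∑ t, truncLogRatio B p₀ (phat D) (D t) -
        ∑ t, Real.log (p₀ (D t).1 (D t).2 / p (D t).1 (D t).2)) / T ∂(dataLaw P T) := by
    rw [integral_div, integral_sub hG hb, integral_sum_dataLaw hint]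
    field_simp
    ring
  rw [hsplit]
  refine ENNReal.ofReal_add_le.trans (add_le_add (ofReal_integral_log_div_le_risk h hcube hint)
    ((ofReal_integral_le_lintegral ((hG.sub hb).div_const _)).trans (lintegral_mono_ae ?_)))
  filter_upwards [ae_dataLaw_of_ae h.ae_pos, ae_dataLaw_of_ae (ae_fst_mem_cube hcube)] with D h1 h2
  refine ENNReal.ofReal_le_ofReal ?_
  -- Needed because a real infimum of an unbounded family would default to `0`.
  have hbdd : BddBelow (Set.range fun q : F => empRisk D q.1) := by
    refine ⟨0, ?_⟩
    rintro _ ⟨q, rfl⟩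
    dsimp only
    rw [empRisk_eq]
    refine div_nonneg (neg_nonneg.2 (Finset.sum_nonpos fun t _ => ?_)) hT0.le
    exact Real.log_nonpos (hpos _ q.2 _ (h2 t) _).le (stdSimplex_le_one (hF _ q.2 _ (h2 t)) _)
  have h3 := ciInf_le hbdd ⟨p, hpF⟩
  have h4 : (∑ t, truncLogRatio B p₀ (phat D) (D t) -
        ∑ t, Real.log (p₀ (D t).1 (D t).2 / p (D t).1 (D t).2)) / T ≤
      empRisk D (phat D) - empRisk D p := by
    rw [empRisk_eq, empRisk_eq, ← sub_div, div_le_div_iff_of_pos_right hT0, neg_sub_neg,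
      ← Finset.sum_sub_distrib, ← Finset.sum_sub_distrib]
    refine Finset.sum_le_sum fun t _ => ?_
    have h5 : truncLogRatio B p₀ (phat D) (D t) ≤ _ := min_le_right _ _
    rw [Real.log_div (h1 t).ne' (hpos _ (hphat D) _ (h2 t) _).ne'] at h5
    rw [Real.log_div (h1 t).ne' (hpos _ hpF _ (h2 t) _).ne']
    linarith
  exact h4.trans (sub_le_sub_left h3 _)

end Likelihood

/-! ### The two expectation bounds -/

section Expectation

variable {d K T : ℕ} {P : Measure (Obs d K)} [IsProbabilityMeasure P] {p₀ : VecFun d K}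
  {F : Set (VecFun d K)} {B M : ℝ} {phat : Data d K T → VecFun d K}

theorem integral_sum_truncKL_le (h : IsTrueClassProb P p₀)
    (hcube : ∀ᵐ z ∂P.fst, z ∈ cube d) (hB : 2 ≤ B) (hT : 0 < T) (hM : 0 < M)
    (hF : ∀ p ∈ F, IsClassProb p)
    (hpos : ∀ p ∈ F, ∀ z ∈ cube d, ∀ k, 0 < p z k) (hphat : ∀ D, phat D ∈ F)
    (hmeas : Measurable fun x : Data d K T × Prompt d => phat x.1 x.2)
    (hnet : ∀ z : Fin T → Prompt d, ∃ G : Finset (VecFun d K), (G.card : ℝ) ≤ M ∧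
      (∀ q ∈ G, q ∈ F) ∧ ∀ p ∈ F, ∃ q ∈ G, ∀ t k,
        |Real.log (p (z t) k) - Real.log (q (z t) k)| ≤ 2 / T) :
    (∫ D, ∑ t, truncKL B (p₀ (D t).1) (phat D (D t).1) ∂(dataLaw P T)) / 2 -
      ∫ D, ∑ t, truncLogRatio B p₀ (phat D) (D t) ∂(dataLaw P T) ≤ 3 + 2 * B * Real.log M := by
  have hG : Integrable (fun D => ∑ t, truncLogRatio B p₀ (phat D) (D t)) (dataLaw P T) :=
    integrable_finsetSum _ fun t _ =>
      integrable_truncLogRatio h hcube (by linarith) hF hpos hphat hmeas t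
  have hA : Integrable (fun D => ∑ t, truncKL B (p₀ (D t).1) (phat D (D t).1)) (dataLaw P T) :=
    integrable_finsetSum _ fun t _ => integrable_truncKL_comp h hB hF hpos hphat hmeas
      measurable_id (measurable_fst.comp (measurable_pi_apply t))
      ((ae_dataLaw_of_ae (ae_fst_mem_cube hcube)).mono fun D hD => hD t)
  rw [← integral_div, ← integral_sub (hA.div_const 2) hG]
  refine h.integral_dataLaw_le hcube ((hA.div_const 2).sub hG) fun z hz => ?_
  obtain ⟨G, h1, h2, h3⟩ := hnet z
  refine le_trans (le_of_eq ?_) (sum_truncKL_sub_truncLogRatio_le hB hT hM h.classProb hF hpos hz h1 h2 h3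
    (fun c => phat fun t => (z t, c t)) fun c => hphat _)
  refine Finset.sum_congr rfl fun c _ => ?_
  rw [Finset.sum_sub_distrib, ← Finset.sum_div]
  rfl

/-- Exchanging the coordinates of the pairs where `σ` is nonzero. -/
def swapPairs {α : Type*} (σ : Fin T → Fin 2) (W : Fin T → α × α) : Fin T → α × α :=
  fun t => if σ t = 0 then W t else (W t).swap

theorem measurePreserving_swapPairs (σ : Fin T → Fin 2) :
    MeasurePreserving (swapPairs σ) (Measure.pi fun _ : Fin T => P.prod P)
      (Measure.pi fun _ : Fin T => P.prod P) := by
  refine measurePreserving_pi (fun _ => P.prod P) (fun _ => P.prod P)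
    (f := fun t w => if σ t = 0 then w else w.swap) fun t => ?_
  split_ifs
  · exact MeasurePreserving.id _
  · exact Measure.measurePreserving_swap

/-- Each entry of `W` pairs an observation with a ghost copy. The estimator is trained on the first
coordinates, so the second ones act as fresh prompts; the joint law is invariant under every
coordinatewise swap. -/
theorem mul_truncRisk_le (h : IsTrueClassProb P p₀)
    (hcube : ∀ᵐ z ∂P.fst, z ∈ cube d) (hB : 2 ≤ B) (hT : 0 < T) (hM : 0 < M)
    (hF : ∀ p ∈ F, IsClassProb p)
    (hpos : ∀ p ∈ F, ∀ z ∈ cube d, ∀ k, 0 < p z k) (hphat : ∀ D, phat D ∈ F)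
    (hmeas : Measurable fun x : Data d K T × Prompt d => phat x.1 x.2)
    (hnet : ∀ z : Fin T → Prompt d, ∃ G : Finset (VecFun d K), (G.card : ℝ) ≤ M ∧
      (∀ q ∈ G, q ∈ F) ∧ ∀ p ∈ F, ∃ q ∈ G, ∀ t k,
        |Real.log (p (z t) k) - Real.log (q (z t) k)| ≤ 2 / T) :
    T * truncRisk P B p₀ phat ≤
      3 * ∫ D, ∑ t, truncKL B (p₀ (D t).1) (phat D (D t).1) ∂(dataLaw P T) +
        (8 + 4 * B * Real.log M) := by
  let κ : Data d K T → Prompt d → ℝ := fun D z => truncKL B (p₀ z) (phat D z)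
  let ν : Measure (Fin T → Obs d K × Obs d K) := Measure.pi fun _ => P.prod P
  have hfst : MeasurePreserving (fun W : Fin T → Obs d K × Obs d K => fun t => (W t).1) ν
      (dataLaw P T) :=
    measurePreserving_pi (fun _ => P.prod P) (fun _ => P) fun _ => measurePreserving_fst
  have hpair : ∀ t, MeasurePreserving
      (fun W : Fin T → Obs d K × Obs d K => ((fun t => (W t).1 : Data d K T), (W t).2.1)) ν
      ((dataLaw P T).prod P.fst) := by
    intro t
    have h1 := measurePreserving_arrowProdEquivProdArrow (Obs d K) (Obs d K) (Fin T)
      (fun _ => P) (fun _ => P)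
    have h2 : MeasurePreserving (fun D : Data d K T => (D t).1) (dataLaw P T) P.fst :=
      MeasurePreserving.comp ⟨measurable_fst, rfl⟩ (measurePreserving_eval (fun _ : Fin T => P) t)
    exact ((MeasurePreserving.id (dataLaw P T)).prod h2).comp h1
  have hW : ∀ᵐ W ∂ν, ∀ t, (W t).1.1 ∈ cube d ∧ (W t).2.1 ∈ cube d := by
    refine ae_all_iff.2 fun t => ?_
    refine (measurePreserving_eval (fun _ : Fin T => P.prod P) t).quasiMeasurePreserving.ae
      (p := fun w : Obs d K × Obs d K => w.1.1 ∈ cube d ∧ w.2.1 ∈ cube d) ?_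
    exact (measurePreserving_fst.quasiMeasurePreserving.ae (ae_fst_mem_cube hcube)).and
      (measurePreserving_snd.quasiMeasurePreserving.ae (ae_fst_mem_cube hcube))
  have hi1 : ∀ t, Integrable (fun W : Fin T → Obs d K × Obs d K =>
      κ (fun t => (W t).1) (W t).1.1) ν := fun t =>
    integrable_truncKL_comp h hB hF hpos hphat hmeas (by fun_prop) (by fun_prop)
      (hW.mono fun W hW => (hW t).1)
  have hi2 : ∀ t, Integrable (fun W : Fin T → Obs d K × Obs d K =>
      κ (fun t => (W t).1) (W t).2.1) ν := fun t =>
    integrable_truncKL_comp h hB hF hpos hphat hmeas (by fun_prop) (by fun_prop)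
      (hW.mono fun W hW => (hW t).2)
  let f : (Fin T → Obs d K × Obs d K) → ℝ := fun W =>
    ∑ t, (κ (fun t => (W t).1) (W t).2.1 - 3 * κ (fun t => (W t).1) (W t).1.1)
  have hf : Integrable f ν := integrable_finsetSum _ fun t _ => (hi2 t).sub ((hi1 t).const_mul 3)
  have hf_int : ∫ W, f W ∂ν = T * truncRisk P B p₀ phat -
      3 * ∫ D, ∑ t, truncKL B (p₀ (D t).1) (phat D (D t).1) ∂(dataLaw P T) := by
    have h1 : ∀ t, ∫ W, κ (fun t => (W t).1) (W t).2.1 ∂ν = truncRisk P B p₀ phat := by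
      intro t
      rw [truncRisk, ← (hpair t).map_eq, integral_map (hpair t).measurable.aemeasurable]
      exact (measurable_truncKL (h.measurable.comp measurable_snd) hmeas).aestronglyMeasurable
    have h2 : ∫ W, ∑ t, κ (fun t => (W t).1) (W t).1.1 ∂ν =
        ∫ D, ∑ t, truncKL B (p₀ (D t).1) (phat D (D t).1) ∂(dataLaw P T) := by
      rw [← hfst.map_eq, integral_map hfst.measurable.aemeasurable]
      exact (Finset.measurable_sum _ fun t _ => measurable_truncKL (h.measurable.comp
        (measurable_fst.comp (measurable_pi_apply t)))
        (measurable_eval_estimator hmeas t)).aestronglyMeasurable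
    simp only [f, Finset.sum_sub_distrib, ← Finset.mul_sum]
    rw [integral_sub (integrable_finsetSum _ fun t _ => hi2 t)
      ((integrable_finsetSum _ fun t _ => hi1 t).const_mul 3),
      integral_finsetSum _ fun t _ => hi2 t, integral_const_mul, h2]
    simp [h1]
  have hfσ : ∀ σ, Integrable (fun W => f (swapPairs σ W)) ν := fun σ =>
    ((measurePreserving_swapPairs σ).integrable_comp hf.aestronglyMeasurable).2 hf
  have hσ : ∀ σ, Measure.map (swapPairs σ) ν = ν := fun σ =>
    (measurePreserving_swapPairs σ).map_eq
  have hfσ_int : ∀ σ, ∫ W, f (swapPairs σ W) ∂ν = ∫ W, f W ∂ν := by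
    intro σ
    conv_rhs => rw [← hσ σ]
    rw [integral_map (measurePreserving_swapPairs (P := P) σ).measurable.aemeasurable]
    rw [hσ σ]
    exact hf.aestronglyMeasurable
  -- Averaging over all swaps inside the integral leaves a finite sum over `σ` for each fixed `W`.
  have havg : ∫ W, f W ∂ν =
      ∫ W, ∑ σ : Fin T → Fin 2, (∏ _t : Fin T, (1 / 2 : ℝ)) * f (swapPairs σ W) ∂ν := by
    rw [integral_finsetSum _ fun σ _ => (hfσ σ).const_mul _]
    simp_rw [integral_const_mul, hfσ_int, ← Finset.sum_mul]
    rw [sum_prod_eq_one (q := fun _ _ => (1 / 2 : ℝ)) (fun t => by norm_num), one_mul]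
  have hle : ∫ W, f W ∂ν ≤ 8 + 4 * B * Real.log M := by
    rw [havg]
    calc _ ≤ ∫ _, (8 + 4 * B * Real.log M) ∂ν := by
          refine integral_mono_ae (integrable_finsetSum _ fun σ _ => (hfσ σ).const_mul _)
            (integrable_const _) (hW.mono fun W hW => ?_)
          -- The nets are taken at the unswapped prompts, hence do not depend on `σ`, whereas the
          -- estimator is trained on the swapped sample.
          obtain ⟨G, h1, h2, h3⟩ := hnet fun t => (W t).1.1
          obtain ⟨G', h1', h2', h3'⟩ := hnet fun t => (W t).2.1
          refine le_trans (le_of_eq ?_) (sum_swap_truncKL_le hB hT hM h.classProb hF hpos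
            (fun t => (hW t).1) (fun t => (hW t).2) h1 h2 h3 h1' h2' h3'
            (fun σ => phat fun t => (swapPairs σ W t).1) fun σ => hphat _)
          refine Finset.sum_congr rfl fun σ _ => ?_
          congr 1
          refine Finset.sum_congr rfl fun t _ => ?_
          have e1 : (swapPairs σ W t).1.1 = if σ t = 0 then (W t).1.1 else (W t).2.1 := by
            simp only [swapPairs]; split_ifs <;> rfl
          have e2 : (swapPairs σ W t).2.1 = if σ t = 0 then (W t).2.1 else (W t).1.1 := by
            simp only [swapPairs]; split_ifs <;> rfl
          simp only [κ, e1, e2]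
      _ = _ := by simp [ν]
  linarith

end Expectation

/-! ### The oracle inequality -/

section Oracle

variable {d K T : ℕ} {P : Measure (Obs d K)} {p₀ : VecFun d K}
  {F : Set (VecFun d K)} {B M : ℝ} {phat : Data d K T → VecFun d K}

theorem ofReal_truncRisk_le [IsProbabilityMeasure P] (h : IsTrueClassProb P p₀)
    (hcube : ∀ᵐ z ∂P.fst, z ∈ cube d) (hB : 2 ≤ B) (hT : 0 < T) (hM : 0 < M)
    (hF : ∀ p ∈ F, Measurable p ∧ IsClassProb p) (hlow : ProbLowerBound F T)
    (hphat : ∀ D, phat D ∈ F)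
    (hmeas : Measurable fun x : Data d K T × Prompt d => phat x.1 x.2)
    (hnet : ∀ z : Fin T → Prompt d, ∃ G : Finset (VecFun d K), (G.card : ℝ) ≤ M ∧
      (∀ q ∈ G, q ∈ F) ∧ ∀ p ∈ F, ∃ q ∈ G, ∀ t k,
        |Real.log (p (z t) k) - Real.log (q (z t) k)| ≤ 2 / T)
    {p : VecFun d K} (hp : p ∈ F) :
    ENNReal.ofReal (truncRisk P B p₀ phat) ≤ 6 * (risk P p₀ p + empGap P F phat) +
      ENNReal.ofReal ((26 + 16 * B * Real.log M) / T) := by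
  have hT0 : (0 : ℝ) < T := by exact_mod_cast hT
  have hpos : ∀ p ∈ F, ∀ z ∈ cube d, ∀ k, 0 < p z k := by
    intro p hp z hz k
    obtain ⟨C₁, C₂, h1, _, _, h4⟩ := hlow p hp
    exact lt_of_lt_of_le (by positivity) (h4 z hz k)
  have hFc : ∀ p ∈ F, IsClassProb p := fun p hp => (hF p hp).2
  have hint : Integrable (fun x : Obs d K => Real.log (p₀ x.1 x.2 / p x.1 x.2)) P := by
    obtain ⟨C₁, C₂, h1, _, _, h4⟩ := hlow p hp
    exact integrable_log_div h hcube (hF p hp).1 (hFc p hp)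
      (a := C₁ / (T : ℝ) ^ C₂) (by positivity) h4
  have h1 := mul_truncRisk_le h hcube hB hT hM hFc hpos hphat hmeas hnet
  have h2 := integral_sum_truncKL_le h hcube hB hT hM hFc hpos hphat hmeas hnet
  have h3 := ofReal_integral_truncLogRatio_le h hcube (B := B) (by linarith) hFc hpos hphat hmeas hT
    hp hint
  set A := ∫ D, ∑ t, truncKL B (p₀ (D t).1) (phat D (D t).1) ∂(dataLaw P T)
  set S := ∫ D, ∑ t, truncLogRatio B p₀ (phat D) (D t) ∂(dataLaw P T)
  -- Insert `A ≤ 2S + 6 + 4B log M` into `T * R_B ≤ 3A + 8 + 4B log M`.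
  have h4 : truncRisk P B p₀ phat ≤ 6 * (S / T) + (26 + 16 * B * Real.log M) / T := by
    rw [← mul_div_assoc, ← add_div, le_div_iff₀ hT0]
    linarith
  calc _ ≤ ENNReal.ofReal (6 * (S / T)) + ENNReal.ofReal ((26 + 16 * B * Real.log M) / T) :=
        (ENNReal.ofReal_le_ofReal h4).trans ENNReal.ofReal_add_le
    _ ≤ _ := by
        rw [ENNReal.ofReal_mul (by norm_num), ENNReal.ofReal_ofNat]
        gcongr

/-- As `B`, `T` and `M` are at least 2, the product `B² log M` is bounded below and absorbs the
constant 26, while `log² T ≥ 0.47` costs only a constant factor. -/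
theorem remainder_le (hB : 2 ≤ B) (hT : 2 ≤ T) (hM : 2 ≤ M) :
    (26 + 16 * B * Real.log M) / T ≤ 100 * (B ^ 2 * Real.log T ^ 2 / T * Real.log M) := by
  have hT2 : (2 : ℝ) ≤ T := by exact_mod_cast hT
  have hl2 := Real.log_two_gt_d9
  have h1 : (0.69 : ℝ) ≤ Real.log T := by
    linarith [Real.log_le_log (by norm_num) hT2]
  have h2 : (0.69 : ℝ) ≤ Real.log M := by
    linarith [Real.log_le_log (by norm_num) hM]
  have h3 : (0.47 : ℝ) ≤ Real.log T ^ 2 := by nlinarith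
  have h4 : (4 : ℝ) ≤ B ^ 2 := by nlinarith
  have h5 : 2 * B ≤ B ^ 2 := by nlinarith
  have h6 : 4 * 0.69 ≤ B ^ 2 * Real.log M := mul_le_mul h4 h2 (by norm_num) (by positivity)
  have h7 : 2 * B * Real.log M ≤ B ^ 2 * Real.log M :=
    mul_le_mul_of_nonneg_right h5 (by linarith)
  have h8 : B ^ 2 * Real.log M * 0.47 ≤ B ^ 2 * Real.log M * Real.log T ^ 2 :=
    mul_le_mul_of_nonneg_left h3 (by linarith)
  rw [show 100 * (B ^ 2 * Real.log T ^ 2 / T * Real.log M) =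
    100 * (B ^ 2 * Real.log M * Real.log T ^ 2) / T by ring]
  gcongr
  linarith

end Oracle

end ICL

theorem mainTheorem1 :
    ∃ C : ℝ, 0 < C ∧
      ∀ (d K T : ℕ) (P : Measure (ICL.Obs d K)) (p₀ : ICL.VecFun d K)
        (F : Set (ICL.VecFun d K)) (phat : ICL.Data d K T → ICL.VecFun d K) (B : ℝ),
        2 ≤ T →
        2 ≤ B →
        IsProbabilityMeasure P →
        (∀ᵐ z ∂P.fst, z ∈ ICL.cube d) →
        ICL.IsTrueClassProb P p₀ →
        (∀ p ∈ F, Measurable p ∧ ICL.IsClassProb p) →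
        ICL.ProbLowerBound F T →
        (∀ D, phat D ∈ F) →
        Measurable (fun x : ICL.Data d K T × ICL.Prompt d => phat x.1 x.2) →
        ENNReal.ofReal (ICL.truncRisk P B p₀ phat) ≤
          ENNReal.ofReal C *
            ((⨅ p ∈ F, ICL.risk P p₀ p) + ICL.empGap P F phat +
              ENNReal.ofReal (B ^ 2 * Real.log T ^ 2 / T) *
                ICL.logCard (max 2 (ICL.unifCoveringNumber (1 / (T : ℝ≥0)) (ICL.logClass F) T))) := by
  refine ⟨100, by norm_num, ?_⟩
  intro d K T P p₀ F phat B hT hB hP hcube h hF hlow hphat hmeas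
  have hT0 : (0 : ℝ) < T := by exact_mod_cast (by omega : 0 < T)
  have hlogT : 0 < Real.log T := Real.log_pos (by exact_mod_cast (by omega : 1 < T))
  rcases eq_or_ne (ICL.unifCoveringNumber (1 / (T : ℝ≥0)) (ICL.logClass F) T) ⊤ with hN | hN
  -- With no finite cover the right side is `⊤`, because the factor of `logCard` is nonzero.
  · have h1 : 0 < B ^ 2 * Real.log T ^ 2 / T := by positivity
    have h2 : ICL.logCard (max 2 ⊤) = ⊤ := by rw [max_eq_right le_top]; rfl
    rw [hN, h2, ENNReal.mul_top (ENNReal.ofReal_pos.2 h1).ne', add_top,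
      ENNReal.mul_top (ENNReal.ofReal_pos.2 (by norm_num)).ne']
    exact le_top
  · obtain ⟨N, hN⟩ := ENat.ne_top_iff_exists.1 hN
    have h2 : ICL.logCard (max 2 (N : ℕ∞)) = ENNReal.ofReal (Real.log ((max 2 N : ℕ) : ℝ)) := by
      have : (max 2 (N : ℕ∞)) = ((max 2 N : ℕ) : ℕ∞) :=
        (Nat.mono_cast.map_max (a := 2) (b := N)).symm
      rw [this]; rfl
    have hM : (2 : ℝ) ≤ ((max 2 N : ℕ) : ℝ) := by exact_mod_cast le_max_left 2 N
    have hnet : ∀ z : Fin T → ICL.Prompt d, ∃ G : Finset (ICL.VecFun d K),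
        (G.card : ℝ) ≤ ((max 2 N : ℕ) : ℝ) ∧ (∀ q ∈ G, q ∈ F) ∧ ∀ p ∈ F, ∃ q ∈ G, ∀ t k,
          |Real.log (p (z t) k) - Real.log (q (z t) k)| ≤ 2 / T := by
      intro z
      obtain ⟨G, hG1, hG2, hG3⟩ := ICL.exists_finset_net hN.symm.le z
      refine ⟨G, hG1.trans (by exact_mod_cast le_max_right 2 N), hG2, ?_⟩
      simpa [div_eq_mul_inv] using hG3
    -- The infimum is moved outside the whole right-hand side, so that one comparator `p` can be
    -- fixed.
    rw [← hN, h2, ← ENNReal.ofReal_mul (by positivity), add_assoc, iInf_subtype', ENNReal.iInf_add,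
      ENNReal.mul_iInf_of_ne (ENNReal.ofReal_pos.2 (by norm_num)).ne' ENNReal.ofReal_ne_top]
    refine le_iInf fun p => (ICL.ofReal_truncRisk_le h hcube hB (by omega) (by linarith) hF hlow hphat
      hmeas hnet p.2).trans ?_
    rw [← add_assoc, mul_add (ENNReal.ofReal 100), ← ENNReal.ofReal_mul (by norm_num)]
    refine add_le_add (mul_le_mul_left ?_ _) (ENNReal.ofReal_le_ofReal (ICL.remainder_le hB hT hM))
    rw [← ENNReal.ofReal_ofNat]
    exact ENNReal.ofReal_le_ofReal (by norm_num)
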